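/- Let $(\Omega,\mathcal A)$ be a measurable space, let $\mathcal P$ be a nonempty set of probability measures on it, and let $\mathbb V(A)=\sup_{P\in\mathcal P}P(A)$ for $A\in\mathcal A$ be the corresponding upper probability. For a random variable $Y\ge 0$ let $\mathbb E[Y]=\sup_{P\in\mathcal P}E_P[Y]\in[0,\infty]$ be the upper expectation. Let $(X_n)_{n\ge1}$ be real random variables on $(\Omega,\mathcal A)$ (no independence or negative dependence is assumed), and let $\overline X_n=\frac1n\sum_{i=1}^n X_i$. With $\ln 0=-\infty$, $\ln\infty=\infty$, put $$\Gamma(\lambda)=\limsup_{n\to\infty}\frac1n\ln\mathbb E\big[e^{n\lambda\overline X_n}\big]\quad(\lambda\in\mathbb R),\qquad \Gamma^*(x)=\sup_{\lambda\in\mathbb R}\big(\lambda x-\Gamma(\lambda)\big)\quad(x\in\mathbb R).$$ Let $\tilde{\mathcal E}(\Gamma^*)$ be the set of all $y\in\mathbb R$ for which there is $\lambda\in\mathbb R$ such that $\lambda y-\Gamma^*(y)>\lambda x-\Gamma^*(x)$ for all $x\ne y$, the limit superior defining $\Gamma(\lambda)$ is a limit in $[-\infty,\infty]$, and $\Gamma(t\lambda)<\infty$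 for some $t>1$. Suppose that $(\overline X_n)$ is exponentially tight under $\mathbb V$: for every $N\in\mathbb N$ there is a compact set $K\subset\mathbb R$ with $\limsup_{n\to\infty}\frac1n\ln\mathbb V(\overline X_n\in K^c)\le -N$. Then, for all closed $F\subset\mathbb R$ and all open $G\subset\mathbb R$, $$\limsup_{n\to\infty}\frac1n\ln\mathbb V(\overline X_n\in F)\le-\inf_{x\in F}\Gamma^*(x)$$ and $$\liminf_{n\to\infty}\frac1n\ln\mathbb V(\overline X_n\in G)\ge-\inf_{x\in G\cap\tilde{\mathcal E}(\Gamma^*)}\Gamma^*(x),$$ where $\inf\emptyset=\infty$. -/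

import Mathlib

open Filter Topology MeasureTheory

noncomputable section

namespace UpperLDP

variable {Ω : Type*} [MeasurableSpace Ω]

/-- The upper probability of the event `A` given by the set `Ps` of probability measures:
the supremum of `P A` over `P ∈ Ps`. -/
def upperProb (Ps : Set (ProbabilityMeasure Ω)) (A : Set Ω) : ENNReal :=
  ⨆ P ∈ Ps, (P : Measure Ω) A

/-- The associated upper expectation of a nonnegative (possibly infinite) random variable `Y`:
the supremum of the expectations `E_P[Y] ∈ [0, ∞]` over `P ∈ Ps`. -/
def upperExp (Ps : Set (ProbabilityMeasure Ω)) (Y : Ω → ENNReal) : ENNReal :=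
  ⨆ P ∈ Ps, ∫⁻ ω, Y ω ∂(P : Measure Ω)

/-- The sample mean `(X₁ + ⋯ + Xₙ) / n`. The variable `X 0` is never used, and only
`n ≥ 1` is meaningful. -/
def sampleMean (X : ℕ → Ω → ℝ) (n : ℕ) (ω : Ω) : ℝ :=
  (1 / (n : ℝ)) * ∑ i ∈ Finset.Icc 1 n, X i ω

/-- `(1 / n) ln a`, with values in `[-∞, ∞]`; here `ln 0 = -∞` and `ln ∞ = ∞`. -/
def normalizedLog (n : ℕ) (a : ENNReal) : EReal :=
  ((1 / (n : ℝ) : ℝ) : EReal) * ENNReal.log a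

/-- Exponential tightness of the sequence of sample means under the upper probability. -/
def ExponentiallyTight (Ps : Set (ProbabilityMeasure Ω)) (X : ℕ → Ω → ℝ) : Prop :=
  ∀ N : ℕ, ∃ K : Set ℝ, IsCompact K ∧
    limsup (fun n : ℕ => normalizedLog n (upperProb Ps {ω | sampleMean X n ω ∈ Kᶜ})) atTop
      ≤ ((-(N : ℝ) : ℝ) : EReal)

/-- `(1 / n) ln 𝔼[exp (n λ X̄ₙ)]`, where `l` stands for `λ`. -/
def scaledCGF (Ps : Set (ProbabilityMeasure Ω)) (X : ℕ → Ω → ℝ) (l : ℝ) (n : ℕ) : EReal :=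
  normalizedLog n
    (upperExp Ps fun ω => ENNReal.ofReal (Real.exp ((n : ℝ) * l * sampleMean X n ω)))

/-- `Γ(λ) = limsup (1 / n) ln 𝔼[exp (n λ X̄ₙ)]`. -/
def Gam (Ps : Set (ProbabilityMeasure Ω)) (X : ℕ → Ω → ℝ) (l : ℝ) : EReal :=
  limsup (scaledCGF Ps X l) atTop

/-- The Fenchel-Legendre transform `f^*(x) = sup_λ (λ x - f(λ))`. -/
def fenchelLegendre (f : ℝ → EReal) (x : ℝ) : EReal :=
  ⨆ l : ℝ, (((l * x : ℝ) : EReal) - f l)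

/-- `l` is an exposing hyperplane of `g` at the point `y`: one has
`l y - g(y) > l x - g(x)` for all `x ≠ y`. -/
def Exposes (g : ℝ → EReal) (l y : ℝ) : Prop :=
  ∀ x : ℝ, x ≠ y → ((l * x : ℝ) : EReal) - g x < ((l * y : ℝ) : EReal) - g y

/-- The set of exposed points of `Γ^*` that have an exposing hyperplane `λ` such that the limit
superior in `Γ(λ)` is a limit and `Γ(t λ) < ∞` for some `t > 1`. -/
def exposedPts (Ps : Set (ProbabilityMeasure Ω)) (X : ℕ → Ω → ℝ) : Set ℝ :=
  {x | ∃ l : ℝ, Exposes (fenchelLegendre (Gam Ps X)) l x ∧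
    Tendsto (scaledCGF Ps X l) atTop (𝓝 (Gam Ps X l)) ∧
    ∃ t : ℝ, 1 < t ∧ Gam Ps X (t * l) < ⊤}

end UpperLDP

end

/-! A supremum over measures is only subadditive, but this suffices for exponential rates: the upper
rate of a sum is the maximum of the two upper rates, and the lower rate is at most the maximum of
one lower and one upper rate (`expGrowthInf_add_le_max`). The proof works with the unnormalized
masses `tilted`. Upper bound: near `x`, a nearly optimal Chernoff parameter makes the `l`-tilted
rate almost as small as `l x - Γ*(x)`; finite covers treat compact sets, and tightness treats closed
ones. Lower bound: if `l` exposes `y`, the same upper bound puts the `l`-tilted rate away from `y`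
strictly below `l y - Γ*(y) ≤ Γ(l)`. The total mass has lower rate `Γ(l)`, so a neighbourhood of `y`
carries it; undoing the tilt there costs about `l y`. -/

open ExpGrowth

namespace UpperLDP

/-- The lower exponential growth of a sum, with the upper growth of one of the terms. -/
lemma expGrowthInf_add_le_max (u v : ℕ → ENNReal) :
    expGrowthInf (u + v) ≤ max (expGrowthInf u) (expGrowthSup v) := by
  have h : expGrowthInf (u + v) ≤ expGrowthInf (u ⊔ v) := by
    refine expGrowthInf_le_of_eventually_le (b := 2) ENNReal.ofNat_ne_top
      (Eventually.of_forall fun n ↦ ?_)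
    rw [Pi.sup_apply, Pi.add_apply, two_mul]
    exact add_le_add le_sup_left le_sup_right
  refine h.trans (expGrowthInf_le_iff.2 fun b hb ↦ ?_)
  obtain ⟨hu, hv⟩ := max_lt_iff.1 hb
  exact ((frequently_le_exp hu).and_eventually (eventually_le_exp hv)).mono
    fun n hn ↦ sup_le hn.1 hn.2

/-- The sequence `exp (n c)` in `[0, ∞]`. -/
noncomputable def expSeq (c : ℝ) (n : ℕ) : ENNReal := ENNReal.ofReal (Real.exp (n * c))

lemma expSeq_eq (c : ℝ) : expSeq c = fun n : ℕ ↦ EReal.exp ((c : EReal) * n) := by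
  funext n
  have : ((c : EReal) * (n : EReal)) = ((n * c : ℝ) : EReal) := by
    rw [mul_comm]; push_cast; rfl
  rw [this, EReal.exp_coe, expSeq]

lemma expGrowthSup_expSeq (c : ℝ) : expGrowthSup (expSeq c) = c := by
  rw [expSeq_eq, expGrowthSup_exp]

lemma expGrowthSup_expSeq_mul_le (c : ℝ) (u : ℕ → ENNReal) :
    expGrowthSup (expSeq c * u) ≤ c + expGrowthSup u := by
  refine (expGrowthSup_mul_le ?_ ?_).trans_eq (by rw [expGrowthSup_expSeq]) <;>
  · left; rw [expGrowthSup_expSeq]; simp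

lemma expGrowthInf_expSeq_mul_le (c : ℝ) (u : ℕ → ENNReal) :
    expGrowthInf (expSeq c * u) ≤ c + expGrowthInf u := by
  refine (expGrowthInf_mul_le ?_ ?_).trans_eq (by rw [expGrowthSup_expSeq]) <;>
  · left; rw [expGrowthSup_expSeq]; simp

lemma normalizedLog_eq (n : ℕ) (a : ENNReal) : normalizedLog n a = ENNReal.log a / n := by
  rw [normalizedLog, EReal.div_eq_inv_mul, one_div, EReal.coe_inv]; rfl

lemma limsup_normalizedLog (u : ℕ → ENNReal) :
    limsup (fun n ↦ normalizedLog n (u n)) atTop = expGrowthSup u := by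
  simp only [normalizedLog_eq]; rfl

lemma liminf_normalizedLog (u : ℕ → ENNReal) :
    liminf (fun n ↦ normalizedLog n (u n)) atTop = expGrowthInf u := by
  simp only [normalizedLog_eq]; rfl

variable {Ω : Type*} [MeasurableSpace Ω]

/-! ### Upper expectations and tilted masses -/

lemma upperExp_mono (Ps : Set (ProbabilityMeasure Ω)) {Y Z : Ω → ENNReal} (h : ∀ ω, Y ω ≤ Z ω) :
    upperExp Ps Y ≤ upperExp Ps Z :=
  iSup₂_mono fun _ _ ↦ lintegral_mono h

lemma upperExp_add_le (Ps : Set (ProbabilityMeasure Ω)) {Y : Ω → ENNReal} (hY : Measurable Y)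
    (Z : Ω → ENNReal) : upperExp Ps (fun ω ↦ Y ω + Z ω) ≤ upperExp Ps Y + upperExp Ps Z := by
  refine iSup₂_le fun P hP ↦ ?_
  rw [lintegral_add_left hY]
  exact add_le_add (le_iSup₂ (f := fun (P : ProbabilityMeasure Ω) (_ : P ∈ Ps) ↦
      ∫⁻ ω, Y ω ∂(P : Measure Ω)) P hP)
    (le_iSup₂ (f := fun (P : ProbabilityMeasure Ω) (_ : P ∈ Ps) ↦
      ∫⁻ ω, Z ω ∂(P : Measure Ω)) P hP)

lemma upperExp_const_mul (Ps : Set (ProbabilityMeasure Ω)) {c : ENNReal} (hc : c ≠ ⊤)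
    (Y : Ω → ENNReal) : upperExp Ps (fun ω ↦ c * Y ω) = c * upperExp Ps Y := by
  simp only [upperExp, ENNReal.mul_iSup, lintegral_const_mul' c _ hc]

/-- The exponentially tilted upper probability `𝔼[exp (n l X̄ₙ); X̄ₙ ∈ A]`. -/
noncomputable def tilted (Ps : Set (ProbabilityMeasure Ω)) (X : ℕ → Ω → ℝ) (l : ℝ) (A : Set ℝ) (n : ℕ) :
    ENNReal :=
  upperExp Ps fun ω ↦ A.indicator (fun z ↦ expSeq (l * z) n) (sampleMean X n ω)

variable {Ps : Set (ProbabilityMeasure Ω)} {X : ℕ → Ω → ℝ}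

lemma measurable_sampleMean (hX : ∀ i, Measurable (X i)) (n : ℕ) :
    Measurable (sampleMean X n) := by
  unfold sampleMean
  exact (Finset.measurable_fun_sum _ fun i _ ↦ hX i).const_mul _

lemma measurable_expSeq (l : ℝ) (n : ℕ) : Measurable fun z : ℝ ↦ expSeq (l * z) n := by
  unfold expSeq; fun_prop

lemma expSeq_ne_top (c : ℝ) (n : ℕ) : expSeq c n ≠ ⊤ := ENNReal.ofReal_ne_top

lemma expSeq_add (a b : ℝ) (n : ℕ) : expSeq (a + b) n = expSeq a n * expSeq b n := by
  rw [expSeq, mul_add, Real.exp_add, ENNReal.ofReal_mul (Real.exp_nonneg _)]; rfl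

lemma expSeq_mono {a b : ℝ} (h : a ≤ b) (n : ℕ) : expSeq a n ≤ expSeq b n :=
  ENNReal.ofReal_le_ofReal (Real.exp_le_exp.2 (by gcongr))

lemma tilted_zero (hX : ∀ i, Measurable (X i)) {A : Set ℝ} (hA : MeasurableSet A) :
    tilted Ps X 0 A = fun n ↦ upperProb Ps {ω | sampleMean X n ω ∈ A} := by
  funext n
  unfold tilted upperExp upperProb
  congr! 4 with P hP
  have hS : MeasurableSet {ω | sampleMean X n ω ∈ A} := measurable_sampleMean hX n hA
  rw [← lintegral_indicator_one hS]
  refine lintegral_congr fun ω ↦ ?_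
  by_cases h : sampleMean X n ω ∈ A <;> simp [h, expSeq]

lemma scaledCGF_eq (l : ℝ) (n : ℕ) :
    scaledCGF Ps X l n = normalizedLog n (tilted Ps X l Set.univ n) := by
  simp only [scaledCGF, tilted, Set.indicator_univ, expSeq, mul_assoc]

lemma Gam_eq (l : ℝ) : Gam Ps X l = expGrowthSup (tilted Ps X l Set.univ) := by
  rw [Gam, ← limsup_normalizedLog]
  congr 1
  funext n
  exact scaledCGF_eq l n

lemma tilted_mono (l : ℝ) {A B : Set ℝ} (h : A ⊆ B) : tilted Ps X l A ≤ tilted Ps X l B :=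
  fun _ ↦ upperExp_mono _ fun _ ↦ Set.indicator_le_indicator_of_subset h (fun _ ↦ zero_le) _

lemma tilted_empty (l : ℝ) : tilted Ps X l ∅ = 0 := by
  funext n
  simp [tilted, upperExp]

lemma tilted_union_le (hX : ∀ i, Measurable (X i)) (l : ℝ) {A : Set ℝ} (hA : MeasurableSet A)
    (B : Set ℝ) : tilted Ps X l (A ∪ B) ≤ tilted Ps X l A + tilted Ps X l B := by
  intro n
  refine (upperExp_mono _ fun ω ↦ ?_).trans (upperExp_add_le Ps
    (((measurable_expSeq l n).indicator hA).comp (measurable_sampleMean hX n)) _)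
  by_cases h : sampleMean X n ω ∈ A <;> by_cases h' : sampleMean X n ω ∈ B <;>
    simp [h, h']

/-- Changing the tilting parameter on a set where the density is at most `exp (n c)`. -/
lemma tilted_le_expSeq_mul (l k c : ℝ) {A : Set ℝ} (h : ∀ z ∈ A, l * z ≤ c + k * z) :
    tilted Ps X l A ≤ expSeq c * tilted Ps X k A := by
  intro n
  rw [Pi.mul_apply, tilted, tilted, ← upperExp_const_mul _ (expSeq_ne_top c n)]
  refine upperExp_mono _ fun ω ↦ ?_
  by_cases hz : sampleMean X n ω ∈ A
  · rw [Set.indicator_of_mem hz, Set.indicator_of_mem hz, ← expSeq_add]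
    exact expSeq_mono (h _ hz) n
  · simp [hz]

/-! ### Upper rates of tilted masses -/

/-- Local upper bound for the tilted upper probabilities. -/
lemma exists_isOpen_expGrowthSup_tilted_lt (l x : ℝ) {m : EReal}
    (h : ((l * x : ℝ) : EReal) - fenchelLegendre (Gam Ps X) x < m) :
    ∃ U : Set ℝ, IsOpen U ∧ x ∈ U ∧ expGrowthSup (tilted Ps X l U) < m := by
  obtain ⟨c, hc, hcm⟩ := EReal.lt_iff_exists_real_btwn.1 h
  have h1 : ((l * x - c : ℝ) : EReal) < fenchelLegendre (Gam Ps X) x := by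
    revert hc
    induction fenchelLegendre (Gam Ps X) x with
    | bot => rw [EReal.coe_sub_bot]; exact fun hc ↦ absurd hc not_top_lt
    | top => exact fun _ ↦ EReal.coe_lt_top _
    | coe r => intro hc; norm_cast at hc ⊢; linarith
  obtain ⟨k, hk⟩ := lt_iSup_iff.1 h1
  -- A real majorant `g` is taken because `Γ(k)` may be `-∞`.
  obtain ⟨g, hg, hgk⟩ : ∃ g : ℝ, Gam Ps X k ≤ g ∧ g < k * x - (l * x - c) := by
    revert hk
    induction Gam Ps X k with
    | bot => exact fun _ ↦ ⟨k * x - (l * x - c) - 1, by simp, by linarith⟩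
    | top => simp
    | coe r => intro hk; norm_cast at hk; exact ⟨r, le_rfl, by linarith⟩
  -- Where `g + (l - k) z < c`, passing from tilt `l` to `k` costs at most `c - g`, so the rate is
  -- at most `(c - g) + g = c`.
  have hcont : Continuous fun z : ℝ ↦ g + (l - k) * z := by fun_prop
  refine ⟨{z | g + (l - k) * z < c}, isOpen_lt hcont continuous_const, ?_, ?_⟩
  · show g + (l - k) * x < c
    linarith
  · refine lt_of_le_of_lt ?_ hcm
    calc expGrowthSup (tilted Ps X l {z | g + (l - k) * z < c})
        ≤ expGrowthSup (expSeq (c - g) * tilted Ps X k Set.univ) := by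
          refine expGrowthSup_monotone ((tilted_le_expSeq_mul l k (c - g) ?_).trans ?_)
          · intro z hz
            have : g + (l - k) * z < c := hz
            linarith
          · intro n
            rw [Pi.mul_apply, Pi.mul_apply]
            gcongr
            exact tilted_mono k (Set.subset_univ _) n
      _ ≤ (c - g : ℝ) + Gam Ps X k := by
          rw [Gam_eq]; exact expGrowthSup_expSeq_mul_le _ _
      _ ≤ (c - g : ℝ) + (g : EReal) := by gcongr
      _ = c := by norm_cast; ring

/-- Upper bound for the tilted upper probabilities on compact sets. -/
lemma expGrowthSup_tilted_lt_of_isCompact (hX : ∀ i, Measurable (X i)) (l : ℝ) {m : EReal}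
    (hm : ⊥ < m) {K : Set ℝ} (hK : IsCompact K)
    (h : ∀ x ∈ K, ((l * x : ℝ) : EReal) - fenchelLegendre (Gam Ps X) x < m) :
    expGrowthSup (tilted Ps X l K) < m := by
  -- Compactness induction runs over arbitrary sets, while subadditivity needs a measurable one;
  -- hence the measurable superset `T`.
  obtain ⟨T, -, hKT, hT⟩ : ∃ T : Set ℝ, MeasurableSet T ∧ K ⊆ T ∧
      expGrowthSup (tilted Ps X l T) < m := by
    refine hK.induction_on (p := fun s ↦ ∃ T : Set ℝ, MeasurableSet T ∧ s ⊆ T ∧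
      expGrowthSup (tilted Ps X l T) < m) ?_ ?_ ?_ ?_
    · exact ⟨∅, .empty, subset_rfl, by rwa [tilted_empty, expGrowthSup_zero]⟩
    · rintro s t hst ⟨T, hT, htT, hlt⟩
      exact ⟨T, hT, hst.trans htT, hlt⟩
    · rintro s t ⟨S, hS, hsS, hSm⟩ ⟨T, hT, htT, hTm⟩
      refine ⟨S ∪ T, hS.union hT, Set.union_subset_union hsS htT, ?_⟩
      refine (expGrowthSup_monotone (tilted_union_le hX l hS T)).trans_lt ?_
      rw [expGrowthSup_add]
      exact max_lt hSm hTm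
    · intro x hx
      obtain ⟨U, hU, hxU, hlt⟩ := exists_isOpen_expGrowthSup_tilted_lt l x (h x hx)
      exact ⟨U, mem_nhdsWithin_of_mem_nhds (hU.mem_nhds hxU), U, hU.measurableSet,
        subset_rfl, hlt⟩
  exact (expGrowthSup_monotone (tilted_mono l hKT)).trans_lt hT

/-- Upper bound for the tilted upper probabilities on closed sets, given a small tail. -/
lemma expGrowthSup_tilted_lt_of_isClosed (hX : ∀ i, Measurable (X i)) (l : ℝ) {m : EReal}
    {F K : Set ℝ} (hF : IsClosed F) (hK : IsCompact K)
    (hKm : expGrowthSup (tilted Ps X l Kᶜ) < m)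
    (h : ∀ x ∈ F, ((l * x : ℝ) : EReal) - fenchelLegendre (Gam Ps X) x < m) :
    expGrowthSup (tilted Ps X l F) < m := by
  have hFK := expGrowthSup_tilted_lt_of_isCompact hX l (bot_le.trans_lt hKm)
    (hK.inter_left hF) fun x hx ↦ h x hx.1
  have hsub : F ⊆ (F ∩ K) ∪ Kᶜ := fun x hx ↦ by
    by_cases hxK : x ∈ K
    · exact Or.inl ⟨hx, hxK⟩
    · exact Or.inr hxK
  refine (expGrowthSup_monotone ((tilted_mono l hsub).trans
    (tilted_union_le hX l (hF.inter hK.isClosed).measurableSet _))).trans_lt ?_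
  rw [expGrowthSup_add]
  exact max_lt hFK hKm

lemma exists_isCompact_expGrowthSup_tilted_zero_le (hX : ∀ i, Measurable (X i))
    (ht : ExponentiallyTight Ps X) (b : ℝ) :
    ∃ K : Set ℝ, IsCompact K ∧ expGrowthSup (tilted Ps X 0 Kᶜ) ≤ b := by
  obtain ⟨N, hN⟩ := exists_nat_ge (-b)
  obtain ⟨K, hK, hle⟩ := ht N
  refine ⟨K, hK, ?_⟩
  rw [limsup_normalizedLog, ← tilted_zero hX hK.isClosed.measurableSet.compl] at hle
  exact hle.trans (EReal.coe_le_coe_iff.2 (by linarith))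

/-- Exponential tightness carries over to the tilted upper probabilities if `Γ (t l) < ∞` for
some `t > 1`. -/
lemma exists_isCompact_expGrowthSup_tilted_le (hX : ∀ i, Measurable (X i))
    (ht : ExponentiallyTight Ps X) (l : ℝ) {t : ℝ} (ht1 : 1 < t) (hfin : Gam Ps X (t * l) < ⊤)
    (b : ℝ) : ∃ K : Set ℝ, IsCompact K ∧ expGrowthSup (tilted Ps X l Kᶜ) ≤ b := by
  obtain ⟨g, hg, -⟩ := EReal.lt_iff_exists_real_btwn.1 hfin
  -- The tail is split at `l z = L`. Below, untilting costs `L`, hence tightness at level `b - L`;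
  -- above, `l z ≤ (b - g) + t l z` holds exactly because `(t - 1) L = g - b`.
  set L : ℝ := (g - b) / (t - 1) with hL
  have htL : (t - 1) * L = g - b := by
    rw [hL, mul_div_cancel₀ _ (by linarith)]
  obtain ⟨K, hK, hKb⟩ := exists_isCompact_expGrowthSup_tilted_zero_le hX ht (b - L)
  refine ⟨K, hK, ?_⟩
  have hmeas : MeasurableSet (Kᶜ ∩ {z : ℝ | l * z ≤ L}) :=
    hK.isClosed.measurableSet.compl.inter
      (measurableSet_le (measurable_const.mul measurable_id) measurable_const)
  have hsub : Kᶜ ⊆ (Kᶜ ∩ {z : ℝ | l * z ≤ L}) ∪ {z : ℝ | L < l * z} := fun z hz ↦ by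
    rcases le_or_gt (l * z) L with h | h
    · exact Or.inl ⟨hz, h⟩
    · exact Or.inr h
  refine (expGrowthSup_monotone ((tilted_mono l hsub).trans
    (tilted_union_le hX l hmeas _))).trans ?_
  rw [expGrowthSup_add]
  refine max_le ?_ ?_
  · calc _ ≤ expGrowthSup (expSeq L * tilted Ps X 0 Kᶜ) := by
          refine expGrowthSup_monotone ((tilted_le_expSeq_mul l 0 L ?_).trans fun n ↦ ?_)
          · rintro z ⟨-, hz⟩
            simpa using hz
          · rw [Pi.mul_apply, Pi.mul_apply]
            gcongr
            exact tilted_mono 0 Set.inter_subset_left n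
      _ ≤ L + ((b - L : ℝ) : EReal) := (expGrowthSup_expSeq_mul_le _ _).trans (by gcongr)
      _ = b := by norm_cast; ring
  · calc _ ≤ expGrowthSup (expSeq (b - g) * tilted Ps X (t * l) Set.univ) := by
          refine expGrowthSup_monotone ((tilted_le_expSeq_mul l (t * l) (b - g) ?_).trans
            fun n ↦ ?_)
          · intro z hz
            have hz' : L < l * z := hz
            nlinarith [mul_lt_mul_of_pos_left hz' (sub_pos.2 ht1)]
          · rw [Pi.mul_apply, Pi.mul_apply]
            gcongr
            exact tilted_mono _ (Set.subset_univ _) n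
      _ ≤ ((b - g : ℝ) : EReal) + g :=
          (expGrowthSup_expSeq_mul_le _ _).trans (by rw [← Gam_eq]; gcongr)
      _ = b := by norm_cast; ring

/-! ### The two large deviation bounds -/

lemma limsup_upperProb_le (hX : ∀ i, Measurable (X i)) (ht : ExponentiallyTight Ps X)
    {F : Set ℝ} (hF : IsClosed F) :
    limsup (fun n : ℕ ↦ normalizedLog n (upperProb Ps {ω | sampleMean X n ω ∈ F})) atTop
      ≤ -(⨅ x ∈ F, fenchelLegendre (Gam Ps X) x) := by
  rw [limsup_normalizedLog, ← tilted_zero hX hF.measurableSet]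
  refine le_of_forall_gt fun m hm ↦ ?_
  obtain ⟨b, hb, hbm⟩ := EReal.lt_iff_exists_real_btwn.1 hm
  obtain ⟨K, hK, hKb⟩ := exists_isCompact_expGrowthSup_tilted_zero_le hX ht b
  refine expGrowthSup_tilted_lt_of_isClosed hX 0 hF hK (hKb.trans_lt hbm) fun x hx ↦ ?_
  refine lt_of_le_of_lt ?_ hm
  rw [zero_mul, EReal.coe_zero, zero_sub, EReal.neg_le_neg_iff]
  exact iInf₂_le x hx

lemma neg_fenchelLegendre_le_liminf (hX : ∀ i, Measurable (X i)) (ht : ExponentiallyTight Ps X)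
    {G : Set ℝ} (hG : IsOpen G) {y : ℝ} (hyG : y ∈ G) (hy : y ∈ exposedPts Ps X) :
    -fenchelLegendre (Gam Ps X) y ≤
      liminf (fun n : ℕ ↦ normalizedLog n (upperProb Ps {ω | sampleMean X n ω ∈ G})) atTop := by
  rw [liminf_normalizedLog, ← tilted_zero hX hG.measurableSet]
  obtain ⟨l, hexp, hlim, t, ht1, hfin⟩ := hy
  set m : EReal := ((l * y : ℝ) : EReal) - fenchelLegendre (Gam Ps X) y with hm
  -- Strict exposure against any other point forces `Γ*(y) < ∞`.
  have hbot : ⊥ < m := bot_le.trans_lt (hexp (y + 1) (by simp))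
  have hmG : m ≤ Gam Ps X l := by
    have : ((l * y : ℝ) : EReal) - Gam Ps X l ≤ fenchelLegendre (Gam Ps X) y :=
      le_iSup (fun k : ℝ ↦ ((k * y : ℝ) : EReal) - Gam Ps X k) l
    rw [hm]
    revert this
    generalize fenchelLegendre (Gam Ps X) y = f
    induction Gam Ps X l with
    | bot => rw [EReal.coe_sub_bot, top_le_iff]; rintro rfl; rw [EReal.sub_top]
    | top => exact fun _ ↦ le_top
    | coe g =>
      intro h
      exact EReal.sub_le_of_le_add' (EReal.sub_le_iff_le_add (by simp) (by simp) |>.1 h)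
  have hinf : Gam Ps X l = expGrowthInf (tilted Ps X l Set.univ) := by
    rw [← hlim.liminf_eq, ← liminf_normalizedLog]
    congr 1
    funext n
    exact scaledCGF_eq l n
  refine le_of_forall_lt fun a ha ↦ ?_
  -- The gap `s - r` is the error allowed for `l z` near `y`: in the end `l y + s < m ≤ l y + (s -
  -- r) + rate(G)`, so the rate of `G` exceeds `r > a`.
  obtain ⟨r, har, hr⟩ := EReal.lt_iff_exists_real_btwn.1 ha
  obtain ⟨s, hrs, hs⟩ := EReal.lt_iff_exists_real_btwn.1 hr
  have hrs' : r < s := EReal.coe_lt_coe_iff.1 hrs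
  set B : Set ℝ := G ∩ {z | l * z < l * y + (s - r)} with hB
  have hBo : IsOpen B := hG.inter (isOpen_lt (by fun_prop) continuous_const)
  have hyB : y ∈ B := ⟨hyG, by show l * y < l * y + (s - r); linarith⟩
  obtain ⟨b, -, hbm⟩ := EReal.lt_iff_exists_real_btwn.1 hbot
  obtain ⟨K, hK, hKb⟩ := exists_isCompact_expGrowthSup_tilted_le hX ht l ht1 hfin b
  have hcompl : expGrowthSup (tilted Ps X l Bᶜ) < m :=
    expGrowthSup_tilted_lt_of_isClosed hX l hBo.isClosed_compl hK (hKb.trans_lt hbm)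
      fun x hx ↦ hexp x (fun h ↦ hx (h ▸ hyB))
  have hΓB : Gam Ps X l ≤ expGrowthInf (tilted Ps X l B) := by
    have h1 : Gam Ps X l ≤
        max (expGrowthInf (tilted Ps X l B)) (expGrowthSup (tilted Ps X l Bᶜ)) := by
      rw [hinf, ← Set.union_compl_self B]
      exact (expGrowthInf_monotone (tilted_union_le hX l hBo.measurableSet _)).trans
        (expGrowthInf_add_le_max _ _)
    -- The complement of `B` has rate below `m ≤ Γ(l)`, so it cannot account for the total mass.
    exact (le_max_iff.1 h1).resolve_right (not_le.2 (hcompl.trans_le hmG))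
  have hBG : expGrowthInf (tilted Ps X l B) ≤
      ((l * y + (s - r) : ℝ) : EReal) + expGrowthInf (tilted Ps X 0 G) := by
    refine (expGrowthInf_monotone ((tilted_le_expSeq_mul l 0 (l * y + (s - r)) ?_).trans
      fun n ↦ ?_)).trans (expGrowthInf_expSeq_mul_le _ _)
    · rintro z ⟨-, hz⟩
      have hz' : l * z < l * y + (s - r) := hz
      linarith
    · rw [Pi.mul_apply, Pi.mul_apply]
      gcongr
      exact tilted_mono 0 Set.inter_subset_left n
  have hsm : ((l * y + s : ℝ) : EReal) < m := by
    rw [hm, sub_eq_add_neg, EReal.coe_add]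
    exact EReal.add_lt_add_left_coe hs _
  refine har.trans ?_
  have := hsm.trans_le (hmG.trans (hΓB.trans hBG))
  revert this
  induction expGrowthInf (tilted Ps X 0 G) with
  | bot => simp
  | top => simp
  | coe v => intro h; norm_cast at h ⊢; linarith

end UpperLDP

theorem theorem4p1 {Ω : Type*} [MeasurableSpace Ω]
    (Ps : Set (ProbabilityMeasure Ω)) (hPs : Ps.Nonempty)
    (X : ℕ → Ω → ℝ) (hX : ∀ i, Measurable (X i))
    (htight : UpperLDP.ExponentiallyTight Ps X) :
    (∀ F : Set ℝ, IsClosed F →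
      limsup (fun n : ℕ => UpperLDP.normalizedLog n
          (UpperLDP.upperProb Ps {ω | UpperLDP.sampleMean X n ω ∈ F})) atTop
        ≤ -(⨅ x ∈ F, UpperLDP.fenchelLegendre (UpperLDP.Gam Ps X) x)) ∧
    (∀ G : Set ℝ, IsOpen G →
      -(⨅ x ∈ G ∩ UpperLDP.exposedPts Ps X, UpperLDP.fenchelLegendre (UpperLDP.Gam Ps X) x)
        ≤ liminf (fun n : ℕ => UpperLDP.normalizedLog n
          (UpperLDP.upperProb Ps {ω | UpperLDP.sampleMean X n ω ∈ G})) atTop) := by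
  refine ⟨fun F hF ↦ UpperLDP.limsup_upperProb_le hX htight hF, fun G hG ↦ ?_⟩
  rw [EReal.neg_le]
  refine le_iInf₂ fun y hy ↦ ?_
  rw [EReal.neg_le]
  exact UpperLDP.neg_fenchelLegendre_le_liminf hX htight hG hy.1 hy.2
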